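/- Let $\mathbb K$ be $\mathbb R$ or $\mathbb C$, let $X$ be either $\ell_p$ with $1\le p<\infty$ or $c_0$ (sequences in $\mathbb K$ indexed by the non-negative integers), and let $\{e_n\}_{n\ge 0}$ be the canonical basis of $X$. Let $w=\{w_n\}_{n\ge 1}$ be a bounded sequence of non-zero numbers in $\mathbb K$, and let $T$ be the backward weighted shift on $X$ with weight sequence $w$, that is, the bounded linear operator with $Te_0=0$ and $Te_n=w_ne_{n-1}$ for $n\ge 1$. Assume that there exists $c>0$ such that $|w_n|\ge c/n$ for every $n\ge 1$. Then $I+T$ satisfies the Kitai Criterion: there exist dense subsets $E$ and $F$ of $X$ and a map $S:F\to F$ such that $(I+T)Sy=y$, $S^ky\to 0$ and $(I+T)^kx\to 0$ as $k\to\infty$ for all $y\in F$ and $x\in E$. -/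

import Mathlib

open Filter Topology
open scoped ENNReal ZeroAtInfty

/-- A bounded linear operator `T` on a normed space satisfies the Kitai Criterion: there are dense
sets `E`, `F` and a (not necessarily linear or continuous) map `S : F → F` with `T S y = y`,
`S ^ k y → 0` and `T ^ k x → 0` for all `y ∈ F`, `x ∈ E`. -/
def SatisfiesKitaiCriterion {𝕜 X : Type*} [NontriviallyNormedField 𝕜] [NormedAddCommGroup X]
    [NormedSpace 𝕜 X] (T : X →L[𝕜] X) : Prop :=
  ∃ (E F : Set X) (S : F → F), Dense E ∧ Dense F ∧
    (∀ y : F, T (S y) = y) ∧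
    (∀ y : F, Tendsto (fun k : ℕ => (S^[k] y : X)) atTop (𝓝 0)) ∧
    (∀ x ∈ E, Tendsto (fun k : ℕ => (T ^ k) x) atTop (𝓝 0))

/-- `T` is the backward weighted shift with respect to the basis `e 0, e 1, …` and with weights
`w 1, w 2, …` (the value `w 0` plays no role): the weights are bounded and non-zero,
`T e₀ = 0` and `T eₙ = wₙ eₙ₋₁` for `n ≥ 1`. -/
structure IsBackwardWeightedShift {𝕜 X : Type*} [NontriviallyNormedField 𝕜]
    [NormedAddCommGroup X] [NormedSpace 𝕜 X] (e : ℕ → X) (w : ℕ → 𝕜) (T : X →L[𝕜] X) : Prop where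
  weight_bounded : ∃ C : ℝ, ∀ n : ℕ, 1 ≤ n → ‖w n‖ ≤ C
  weight_ne_zero : ∀ n : ℕ, 1 ≤ n → w n ≠ 0
  apply_zero : T (e 0) = 0
  apply_basis : ∀ n : ℕ, 1 ≤ n → T (e n) = w n • e (n - 1)

/-- The canonical basis of `ℓ_p`, the space `lp (fun _ : ℕ => 𝕜) p`. -/
noncomputable def lpBasis (𝕜 : Type*) [RCLike 𝕜] (p : ℝ≥0∞) (n : ℕ) : lp (fun _ : ℕ => 𝕜) p :=
  lp.single p n (1 : 𝕜)

/-- The canonical basis of `c₀`, realised as the space `C₀(ℕ, 𝕜)` of functions on the discrete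
space `ℕ` which tend to zero at infinity, with the supremum norm. -/
noncomputable def c0Basis (𝕜 : Type*) [RCLike 𝕜] (n : ℕ) : C₀(ℕ, 𝕜) where
  toFun := Pi.single n (1 : 𝕜)
  continuous_toFun := continuous_of_discreteTopology
  zero_at_infty' := by
    rw [Filter.cocompact_eq_cofinite]
    refine tendsto_nhds_of_eventually_eq ?_
    refine (Set.finite_singleton n).subset fun m hm => ?_
    by_contra h
    exact hm (Pi.single_eq_of_ne h 1)

section Volterra

variable {𝕜 : Type*} [RCLike 𝕜]

theorem hasDerivAt_integral_to (a : ℝ) (f : C(ℝ, 𝕜)) (s : ℝ) :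
    HasDerivAt (fun s => ∫ t in s..a, f t) (-f s) s :=
  intervalIntegral.integral_hasDerivAt_left (f.continuous.intervalIntegrable _ _)
    f.continuous.aestronglyMeasurable.stronglyMeasurableAtFilter f.continuous.continuousAt

/-- The adjoint Volterra operator `f ↦ (s ↦ ∫ t in s..a, f t)` on continuous functions. -/
noncomputable def volterra (𝕜 : Type*) [RCLike 𝕜] (a : ℝ) : C(ℝ, 𝕜) →ₗ[𝕜] C(ℝ, 𝕜) where
  toFun f := ⟨fun s => ∫ t in s..a, f t,
    continuous_iff_continuousAt.2 fun s => (hasDerivAt_integral_to a f s).continuousAt⟩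
  map_add' f g := by
    ext s
    exact intervalIntegral.integral_add (f.continuous.intervalIntegrable _ _)
      (g.continuous.intervalIntegrable _ _)
  map_smul' c f := by
    ext s
    exact intervalIntegral.integral_smul c f

theorem hasDerivAt_volterra (a : ℝ) (f : C(ℝ, 𝕜)) (s : ℝ) :
    HasDerivAt (volterra 𝕜 a f) (-f s) s :=
  hasDerivAt_integral_to a f s

@[simp]
theorem volterra_apply_self (a : ℝ) (f : C(ℝ, 𝕜)) : volterra 𝕜 a f a = 0 :=
  intervalIntegral.integral_same

/-- `volterra 𝕜 a f` is the only antiderivative of `-f` vanishing at `a`. -/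
theorem eq_volterra_of_hasDerivAt {a : ℝ} {f g : C(ℝ, 𝕜)}
    (hg : ∀ s, HasDerivAt g (-f s) s) (ha : g a = 0) : g = volterra 𝕜 a f := by
  ext s
  have h := intervalIntegral.integral_eq_sub_of_hasDerivAt (a := s) (b := a)
    (fun t _ => hg t) (f.continuous.neg.intervalIntegrable _ _)
  rw [intervalIntegral.integral_neg, ha, zero_sub, neg_inj] at h
  exact h.symm

/-- The exponential `t ↦ exp (r * t)` with values in `𝕜`. -/
noncomputable def expMap (𝕜 : Type*) [RCLike 𝕜] (r : ℝ) : C(ℝ, 𝕜) :=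
  ⟨fun t => (Real.exp (r * t) : 𝕜), by fun_prop⟩

theorem expMap_apply (r t : ℝ) : expMap 𝕜 r t = (Real.exp (r * t) : 𝕜) := rfl

theorem hasDerivAt_expMap (r t : ℝ) : HasDerivAt (expMap 𝕜 r) (r * expMap 𝕜 r t) t := by
  have h : HasDerivAt (fun t => Real.exp (r * t)) (Real.exp (r * t) * (r * 1)) t :=
    ((hasDerivAt_id t).const_mul r).exp
  have h' : HasDerivAt (expMap 𝕜 r) ((Real.exp (r * t) * (r * 1) : ℝ) : 𝕜) t := by
    simpa using! (RCLike.ofRealCLM (K := 𝕜)).hasFDerivAt.comp_hasDerivAt t h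
  refine h'.congr_deriv ?_
  rw [expMap_apply]
  push_cast
  ring

theorem expMap_neg_mul (r : ℝ) : expMap 𝕜 (-r) * expMap 𝕜 r = 1 := by
  ext t
  simp only [ContinuousMap.mul_apply, expMap_apply, ← RCLike.ofReal_mul, ← Real.exp_add]
  simp

theorem expMap_mul_volterra (r a : ℝ) (f : C(ℝ, 𝕜)) :
    expMap 𝕜 r * volterra 𝕜 a f =
      volterra 𝕜 a (expMap 𝕜 r * (f - (r : 𝕜) • volterra 𝕜 a f)) := by
  refine eq_volterra_of_hasDerivAt (fun s => ?_) (by simp)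
  refine ((hasDerivAt_expMap r s).mul (hasDerivAt_volterra a f s)).congr_deriv ?_
  simp only [ContinuousMap.mul_apply, ContinuousMap.sub_apply, ContinuousMap.smul_apply,
    smul_eq_mul]
  ring

/-- The inverse of `1 + volterra 𝕜 a`, as a conjugate of `1 - volterra 𝕜 a`. -/
noncomputable def volterraResolvent (𝕜 : Type*) [RCLike 𝕜] (a : ℝ) (f : C(ℝ, 𝕜)) : C(ℝ, 𝕜) :=
  f - expMap 𝕜 1 * volterra 𝕜 a (expMap 𝕜 (-1) * f)

theorem volterraResolvent_add_volterra (a : ℝ) (f : C(ℝ, 𝕜)) :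
    volterraResolvent 𝕜 a f + volterra 𝕜 a (volterraResolvent 𝕜 a f) = f := by
  have h1 := expMap_mul_volterra 1 a (expMap 𝕜 (-1) * f)
  have h2 : expMap 𝕜 1 * (expMap 𝕜 (-1) * f - ((1 : ℝ) : 𝕜) •
      volterra 𝕜 a (expMap 𝕜 (-1) * f)) = volterraResolvent 𝕜 a f := by
    rw [volterraResolvent, mul_sub, ← mul_assoc, mul_comm (expMap 𝕜 1), expMap_neg_mul]
    simp
  rw [h2] at h1
  rw [← h1, volterraResolvent, sub_add_cancel]

theorem expMap_mul_volterraResolvent (a : ℝ) (f : C(ℝ, 𝕜)) :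
    expMap 𝕜 (-1) * volterraResolvent 𝕜 a f =
      (1 - volterra 𝕜 a) (expMap 𝕜 (-1) * f) := by
  rw [volterraResolvent, mul_sub, ← mul_assoc, expMap_neg_mul, one_mul]
  rfl

theorem expMap_mul_volterraResolvent_iterate (a : ℝ) (f : C(ℝ, 𝕜)) (k : ℕ) :
    expMap 𝕜 (-1) * (volterraResolvent 𝕜 a)^[k] f =
      ((1 - volterra 𝕜 a) ^ k) (expMap 𝕜 (-1) * f) := by
  induction k with
  | zero => simp
  | succ k ih =>
    rw [Function.iterate_succ_apply', expMap_mul_volterraResolvent, ih, pow_succ']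
    rfl

theorem expMap_mul_volterra_volterraResolvent (a : ℝ) (f : C(ℝ, 𝕜)) :
    expMap 𝕜 (-1) * volterra 𝕜 a (volterraResolvent 𝕜 a f) =
      volterra 𝕜 a (expMap 𝕜 (-1) * f) := by
  rw [expMap_mul_volterra]
  congr 2
  conv_rhs => rw [← volterraResolvent_add_volterra a f]
  ext t
  simp

/-- The square of the `L²` norm on `[0, a]` with weight `exp (2 t)`. -/
noncomputable def expEnergy (a : ℝ) (f : C(ℝ, 𝕜)) : ℝ :=
  ∫ t in 0..a, Real.exp (2 * t) * ‖f t‖ ^ 2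

theorem expEnergy_nonneg {a : ℝ} (ha : 0 ≤ a) (f : C(ℝ, 𝕜)) : 0 ≤ expEnergy a f :=
  intervalIntegral.integral_nonneg ha fun _ _ => by positivity

theorem expEnergy_sub_volterra (a : ℝ) (f : C(ℝ, 𝕜)) :
    expEnergy a ((1 - volterra 𝕜 a) f) =
      expEnergy a f - ‖volterra 𝕜 a f 0‖ ^ 2 - expEnergy a (volterra 𝕜 a f) := by
  set u := volterra 𝕜 a f with hu
  have hint : ∀ g : C(ℝ, 𝕜), IntervalIntegrable (fun t => Real.exp (2 * t) * ‖g t‖ ^ 2)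
      MeasureTheory.volume 0 a := fun g => Continuous.intervalIntegrable (by fun_prop) _ _
  have hre : ∀ t, HasDerivAt (fun t => RCLike.re (u t)) (-RCLike.re (f t)) t := fun t => by
    simpa using! (RCLike.reCLM (K := 𝕜)).hasFDerivAt.comp_hasDerivAt t (hasDerivAt_volterra a f t)
  have him : ∀ t, HasDerivAt (fun t => RCLike.im (u t)) (-RCLike.im (f t)) t := fun t => by
    simpa using! (RCLike.imCLM (K := 𝕜)).hasFDerivAt.comp_hasDerivAt t (hasDerivAt_volterra a f t)
  have hexp : ∀ t : ℝ, HasDerivAt (fun t => Real.exp (2 * t)) (Real.exp (2 * t) * (2 * 1)) t :=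
    fun t => ((hasDerivAt_id t).const_mul 2).exp
  have hderiv : ∀ t, HasDerivAt (fun t => Real.exp (2 * t) * ‖u t‖ ^ 2)
      (Real.exp (2 * t) * ‖((1 - volterra 𝕜 a) f) t‖ ^ 2 - Real.exp (2 * t) * ‖f t‖ ^ 2 +
        Real.exp (2 * t) * ‖u t‖ ^ 2) t := fun t => by
    have hsub : ((1 - volterra 𝕜 a) f) t = f t - u t := rfl
    simp only [hsub, RCLike.norm_sq_eq_def, map_sub]
    refine ((hexp t).mul (((hre t).mul (hre t)).add ((him t).mul (him t)))).congr_deriv ?_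
    simp only [Pi.add_apply, Pi.mul_apply]
    ring
  have h := intervalIntegral.integral_eq_sub_of_hasDerivAt (a := 0) (b := a)
    (fun t _ => hderiv t) (((hint _).sub (hint _)).add (hint _))
  rw [intervalIntegral.integral_add ((hint _).sub (hint _)) (hint _),
    intervalIntegral.integral_sub (hint _) (hint _)] at h
  have hua : u a = 0 := volterra_apply_self a f
  rw [hua, norm_zero, mul_zero, Real.exp_zero, one_mul, zero_pow two_ne_zero, mul_zero] at h
  simp only [expEnergy]
  linarith

theorem tendsto_expEnergy_volterra_pow {a : ℝ} (ha : 0 ≤ a) (f : C(ℝ, 𝕜)) :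
    Tendsto (fun k : ℕ => expEnergy a (volterra 𝕜 a (((1 - volterra 𝕜 a) ^ k) f)))
      atTop (𝓝 0) := by
  set N : ℕ → ℝ := fun k => expEnergy a (((1 - volterra 𝕜 a) ^ k) f) with hN
  have hstep : ∀ k, expEnergy a (volterra 𝕜 a (((1 - volterra 𝕜 a) ^ k) f)) ≤ N k - N (k + 1) := by
    intro k
    have h := expEnergy_sub_volterra a (((1 - volterra 𝕜 a) ^ k) f)
    have hs : (1 - volterra 𝕜 a) (((1 - volterra 𝕜 a) ^ k) f) =
        ((1 - volterra 𝕜 a) ^ (k + 1)) f := by rw [pow_succ']; rfl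
    rw [hs] at h
    simp only [hN]
    nlinarith [sq_nonneg ‖volterra 𝕜 a (((1 - volterra 𝕜 a) ^ k) f) 0‖]
  have hanti : Antitone N := antitone_nat_of_succ_le fun k => by
    linarith [hstep k, expEnergy_nonneg ha (volterra 𝕜 a (((1 - volterra 𝕜 a) ^ k) f))]
  have hlim := tendsto_atTop_ciInf hanti ⟨0, by rintro _ ⟨k, rfl⟩; exact expEnergy_nonneg ha _⟩
  have hdiff := hlim.sub (hlim.comp (tendsto_add_atTop_nat 1))
  rw [sub_self] at hdiff
  exact squeeze_zero (fun k => expEnergy_nonneg ha _) hstep hdiff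

theorem tendsto_integral_norm_sq_volterra_pow {a : ℝ} (ha : 0 ≤ a) (f : C(ℝ, 𝕜)) :
    Tendsto (fun k : ℕ => ∫ t in 0..a, ‖volterra 𝕜 a (((1 - volterra 𝕜 a) ^ k) f) t‖ ^ 2)
      atTop (𝓝 0) := by
  refine squeeze_zero (fun k => intervalIntegral.integral_nonneg ha fun _ _ => by positivity)
    (fun k => ?_) (tendsto_expEnergy_volterra_pow ha f)
  refine intervalIntegral.integral_mono_on ha (Continuous.intervalIntegrable (by fun_prop) _ _)
    (Continuous.intervalIntegrable (by fun_prop) _ _) fun t ht => ?_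
  exact le_mul_of_one_le_left (by positivity) (Real.one_le_exp (by linarith [ht.1]))

theorem tendsto_integral_norm_sq_volterra_volterraResolvent {a : ℝ} (ha : 0 ≤ a) (f : C(ℝ, 𝕜)) :
    Tendsto (fun k : ℕ => ∫ t in 0..a, ‖volterra 𝕜 a ((volterraResolvent 𝕜 a)^[k] f) t‖ ^ 2)
      atTop (𝓝 0) := by
  rw [← tendsto_add_atTop_iff_nat 1]
  refine (tendsto_expEnergy_volterra_pow ha (expMap 𝕜 (-1) * f)).congr fun k => ?_
  rw [← expMap_mul_volterraResolvent_iterate, ← expMap_mul_volterra_volterraResolvent,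
    ← Function.iterate_succ_apply' (volterraResolvent 𝕜 a)]
  refine intervalIntegral.integral_congr fun t _ => ?_
  simp only [ContinuousMap.mul_apply, norm_mul, expMap_apply, RCLike.norm_ofReal, Real.abs_exp,
    mul_pow, ← Real.exp_nat_mul]
  rw [← mul_assoc, ← Real.exp_add]
  simp

theorem norm_volterra_pow_le {a M : ℝ} {f : C(ℝ, 𝕜)}
    (hf : ∀ t ∈ Set.Icc 0 a, ‖f t‖ ≤ M) (n : ℕ) :
    ∀ t ∈ Set.Icc 0 a, ‖((volterra 𝕜 a) ^ n) f t‖ ≤ a ^ n * M := by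
  induction n with
  | zero => simpa using hf
  | succ n ih =>
    intro s hs
    have hM : 0 ≤ a ^ n * M := (norm_nonneg _).trans (ih s hs)
    rw [pow_succ']
    change ‖∫ t in s..a, ((volterra 𝕜 a) ^ n) f t‖ ≤ _
    calc ‖∫ t in s..a, ((volterra 𝕜 a) ^ n) f t‖ ≤ a ^ n * M * |a - s| := by
          refine intervalIntegral.norm_integral_le_of_norm_le_const fun t ht => ih t ?_
          rw [Set.uIoc_of_le hs.2] at ht
          exact ⟨hs.1.trans ht.1.le, ht.2⟩
      _ ≤ a ^ n * M * a := by
          rw [abs_of_nonneg (by linarith [hs.2])]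
          gcongr
          linarith [hs.1]
      _ = a ^ (n + 1) * M := by ring

end Volterra

section PowerSeriesCurve

variable {X : Type*} [NormedAddCommGroup X] [NormedSpace ℝ X] {c : ℝ} {v : ℕ → X}

/-- The curve given by the power series with coefficients `v`. -/
noncomputable def powerCurve (v : ℕ → X) (t : ℝ) : X := ∑' n, t ^ n • v n

theorem norm_pow_smul_le (hv : ∀ n, ‖v n‖ ≤ c⁻¹ ^ n) {b t : ℝ} (ht : |t| ≤ b)
    (n : ℕ) : ‖t ^ n • v n‖ ≤ (b / c) ^ n := by
  rw [norm_smul, norm_pow, Real.norm_eq_abs, div_eq_mul_inv, mul_pow]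
  have := hv n
  have hb : 0 ≤ b := (abs_nonneg t).trans ht
  gcongr

theorem summable_div_pow (hc : 0 < c) {b : ℝ} (hb : 0 ≤ b) (hbc : b < c) :
    Summable fun n : ℕ => (b / c) ^ n :=
  summable_geometric_of_lt_one (by positivity) ((div_lt_one hc).2 hbc)

theorem hasSum_powerCurve [CompleteSpace X] (hc : 0 < c) (hv : ∀ n, ‖v n‖ ≤ c⁻¹ ^ n) {t : ℝ}
    (ht : |t| < c) : HasSum (fun n => t ^ n • v n) (powerCurve v t) :=
  (Summable.of_norm_bounded (summable_div_pow hc (abs_nonneg t) ht)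
    (norm_pow_smul_le hv le_rfl)).hasSum

theorem continuousOn_powerCurve [CompleteSpace X] (hc : 0 < c) (hv : ∀ n, ‖v n‖ ≤ c⁻¹ ^ n) {b : ℝ} (hb : 0 ≤ b)
    (hbc : b < c) : ContinuousOn (powerCurve v) (Set.Icc (-b) b) :=
  continuousOn_tsum (fun n => by fun_prop) (summable_div_pow hc hb hbc)
    fun n _ ht => norm_pow_smul_le hv (abs_le.2 ht) n

theorem powerCurve_zero (v : ℕ → X) : powerCurve v 0 = v 0 := by
  rw [powerCurve, tsum_eq_single 0 fun n hn => by simp [hn]]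
  simp

theorem hasDerivAt_map_powerCurve [CompleteSpace X] (hc : 0 < c) (hv : ∀ n, ‖v n‖ ≤ c⁻¹ ^ n)
    {T : X →L[ℝ] X} (hT0 : T (v 0) = 0) (hT : ∀ n : ℕ, T (v (n + 1)) = ((n : ℝ) + 1)⁻¹ • v n)
    {t : ℝ} (ht : |t| < c) : HasDerivAt (fun t => T (powerCurve v t)) (powerCurve v t) t := by
  obtain ⟨b, htb, hbc⟩ := exists_between ht
  have hb : 0 < b := (abs_nonneg t).trans_lt htb
  have hseries : ∀ s : ℝ, |s| < c →
      T (powerCurve v s) = ∑' n : ℕ, (s ^ (n + 1) * ((n : ℝ) + 1)⁻¹) • v n := by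
    intro s hs
    have h := (hasSum_powerCurve hc hv hs).mapL T
    rw [← hasSum_nat_add_iff' 1] at h
    simp only [Finset.range_one, Finset.sum_singleton, map_smul, hT0, smul_zero, sub_zero, hT,
      smul_smul] at h
    exact h.tsum_eq.symm
  have hder : HasDerivAt (fun s : ℝ => ∑' n : ℕ, (s ^ (n + 1) * ((n : ℝ) + 1)⁻¹) • v n)
      (∑' n : ℕ, t ^ n • v n) t := by
    refine hasDerivAt_tsum_of_isPreconnected (t := Set.Ioo (-b) b) (y₀ := 0)
      (summable_div_pow hc hb.le hbc) isOpen_Ioo isPreconnected_Ioo (fun n s _ => ?_)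
      (fun n s hs => norm_pow_smul_le hv (abs_le.2 ⟨hs.1.le, hs.2.le⟩) n)
      ⟨by linarith, hb⟩ (by simp) (abs_lt.1 htb)
    refine (((hasDerivAt_pow (n + 1) s).mul_const ((n : ℝ) + 1)⁻¹).smul_const (v n)).congr_deriv ?_
    congr 1
    push_cast
    have : (n : ℝ) + 1 ≠ 0 := by positivity
    field_simp
  refine hder.congr_of_eventuallyEq ?_
  filter_upwards [(continuous_abs.tendsto t).eventually (gt_mem_nhds ht)] with s hs
  exact hseries s hs

/-- A power series vanishing on a right or left neighbourhood of `0` has zero coefficients. -/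
theorem coeff_eq_zero_of_hasSum_zero {E : Type*} [NormedAddCommGroup E] [NormedSpace ℝ E]
    {a σ : ℝ} (ha : 0 < a) (hσ : σ ≠ 0) {G : ℝ → E} {d : ℕ → E}
    (hG : ∀ᶠ t in 𝓝 0, HasSum (fun n => t ^ n • d n) (G t))
    (hG0 : ∀ t ∈ Set.Icc 0 a, G (σ * t) = 0) (n : ℕ) : d n = 0 := by
  set p : FormalMultilinearSeries ℝ ℝ E :=
    fun n => ContinuousMultilinearMap.mkPiRing ℝ (Fin n) (d n) with hp
  have hcoeff : ∀ n, p.coeff n = d n := fun n => by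
    simp [FormalMultilinearSeries.coeff, hp]
  have hps : HasFPowerSeriesAt G p 0 := by
    rw [hasFPowerSeriesAt_iff]
    simpa only [hcoeff, zero_add] using hG
  have hp0 : p = 0 := by
    by_contra hne
    have h := hps.locally_ne_zero hne
    have htend : Tendsto (fun t : ℝ => σ * t) (𝓝[>] 0) (𝓝[≠] 0) := by
      refine tendsto_nhdsWithin_iff.2 ⟨?_, ?_⟩
      · have : Tendsto (fun t : ℝ => σ * t) (𝓝 0) (𝓝 (σ * 0)) := by
          exact (continuous_const_mul σ).tendsto 0
        rw [mul_zero] at this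
        exact this.mono_left nhdsWithin_le_nhds
      · filter_upwards [self_mem_nhdsWithin] with t ht
        exact mul_ne_zero hσ (ne_of_gt ht)
    obtain ⟨t, ht, ht'⟩ := ((htend.eventually h).and (Ioo_mem_nhdsGT ha)).exists
    exact ht (hG0 t ⟨ht'.1.le, ht'.2.le⟩)
  rw [← hcoeff n, hp0]
  simp [FormalMultilinearSeries.coeff]

end PowerSeriesCurve

section CurveAverage

variable {𝕜 X : Type*} [RCLike 𝕜] [NormedAddCommGroup X] [NormedSpace 𝕜 X]
  {a : ℝ} {y : ℝ → X}

theorem intervalIntegrable_smul_curve (ha : 0 ≤ a) (hy : ContinuousOn y (Set.Icc 0 a))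
    (f : C(ℝ, 𝕜)) : IntervalIntegrable (fun t => f t • y t) MeasureTheory.volume 0 a := by
  refine ContinuousOn.intervalIntegrable ?_
  rw [Set.uIcc_of_le ha]
  exact f.continuous.continuousOn.smul hy

variable [NormedSpace ℝ X] [IsScalarTower ℝ 𝕜 X]

/-- The weighted average `f ↦ ∫ t in 0..a, f t • y t` of a curve. -/
noncomputable def curveAverage (𝕜 : Type*) [RCLike 𝕜] [NormedSpace 𝕜 X] [IsScalarTower ℝ 𝕜 X]
    (ha : 0 ≤ a) (hy : ContinuousOn y (Set.Icc 0 a)) : C(ℝ, 𝕜) →ₗ[𝕜] X where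
  toFun f := ∫ t in 0..a, f t • y t
  map_add' f g := by
    simp only [ContinuousMap.add_apply, add_smul]
    exact intervalIntegral.integral_add (intervalIntegrable_smul_curve ha hy f)
      (intervalIntegrable_smul_curve ha hy g)
  map_smul' r f := by
    simp only [ContinuousMap.smul_apply, smul_assoc, RingHom.id_apply]
    exact intervalIntegral.integral_smul r _

theorem curveAverage_apply (ha : 0 ≤ a) (hy : ContinuousOn y (Set.Icc 0 a)) (f : C(ℝ, 𝕜)) :
    curveAverage 𝕜 ha hy f = ∫ t in 0..a, f t • y t := rfl

theorem map_curveAverage [CompleteSpace X] (ha : 0 ≤ a) (hy : ContinuousOn y (Set.Icc 0 a))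
    {T : X →L[𝕜] X} {σ : ℝ} (hT0 : T (y 0) = 0)
    (hT : ∀ t ∈ Set.Icc 0 a, HasDerivAt (fun t => T (y t)) (σ • y t) t) (f : C(ℝ, 𝕜)) :
    T (curveAverage 𝕜 ha hy f) = (σ : 𝕜) • curveAverage 𝕜 ha hy (volterra 𝕜 a f) := by
  have hTy : ContinuousOn (fun t => T (y t)) (Set.Icc 0 a) := T.continuous.comp_continuousOn hy
  have hint : IntervalIntegrable (fun t => -(f t • T (y t))) MeasureTheory.volume 0 a :=
    (intervalIntegrable_smul_curve ha hTy f).neg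
  have hint' : IntervalIntegrable (fun t => volterra 𝕜 a f t • σ • y t)
      MeasureTheory.volume 0 a := intervalIntegrable_smul_curve ha (hy.const_smul σ) _
  have h := intervalIntegral.integral_eq_sub_of_hasDerivAt (a := 0) (b := a)
    (f := fun t => volterra 𝕜 a f t • T (y t))
    (f' := fun t => volterra 𝕜 a f t • σ • y t + -(f t • T (y t)))
    (fun t ht => ?_) (hint'.add hint)
  · rw [volterra_apply_self, zero_smul, hT0, smul_zero, sub_zero,
      intervalIntegral.integral_add hint' hint] at h
    rw [intervalIntegral.integral_neg, ← sub_eq_add_neg, sub_eq_zero] at h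
    rw [curveAverage_apply, curveAverage_apply, ← T.intervalIntegral_comp_comm
      (intervalIntegrable_smul_curve ha hy f), ← intervalIntegral.integral_smul]
    simp only [map_smul]
    rw [← h]
    refine intervalIntegral.integral_congr fun t _ => ?_
    simp only [RCLike.real_smul_eq_coe_smul (K := 𝕜) σ]
    rw [smul_comm]
  · rw [Set.uIcc_of_le ha] at ht
    refine ((hasDerivAt_volterra a f t).smul (hT t ht)).congr_deriv ?_
    rw [neg_smul]

theorem exists_norm_curveAverage_le (ha : 0 ≤ a) (hy : ContinuousOn y (Set.Icc 0 a)) :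
    ∃ C, 0 ≤ C ∧ ∀ f : C(ℝ, 𝕜), ‖curveAverage 𝕜 ha hy f‖ ≤ C * ∫ t in 0..a, ‖f t‖ := by
  obtain ⟨C, hC⟩ := isCompact_Icc.exists_bound_of_continuousOn hy
  refine ⟨C, (norm_nonneg _).trans (hC 0 ⟨le_rfl, ha⟩), fun f => ?_⟩
  rw [← intervalIntegral.integral_const_mul]
  refine intervalIntegral.norm_integral_le_of_norm_le ha ?_
    (Continuous.intervalIntegrable (by fun_prop) _ _)
  refine Eventually.of_forall fun t ht => ?_
  rw [norm_smul, mul_comm]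
  gcongr
  exact hC t ⟨ht.1.le, ht.2⟩

theorem tendsto_curveAverage_zero (ha : 0 ≤ a) (hy : ContinuousOn y (Set.Icc 0 a))
    {f : ℕ → C(ℝ, 𝕜)} (hf : Tendsto (fun k => ∫ t in 0..a, ‖f k t‖ ^ 2) atTop (𝓝 0)) :
    Tendsto (fun k => curveAverage 𝕜 ha hy (f k)) atTop (𝓝 0) := by
  obtain ⟨C, hC0, hC⟩ := exists_norm_curveAverage_le (𝕜 := 𝕜) ha hy
  have hL1 : Tendsto (fun k => ∫ t in 0..a, ‖f k t‖) atTop (𝓝 0) := by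
    have hnn : ∀ k, 0 ≤ ∫ t in 0..a, ‖f k t‖ := fun k =>
      intervalIntegral.integral_nonneg ha fun _ _ => norm_nonneg _
    have hle : ∀ δ > 0, ∀ k, ∫ t in 0..a, ‖f k t‖ ≤
        a * δ + δ⁻¹ * ∫ t in 0..a, ‖f k t‖ ^ 2 := by
      intro δ hδ k
      have hi : IntervalIntegrable (fun t => ‖f k t‖ ^ 2) MeasureTheory.volume 0 a :=
        Continuous.intervalIntegrable (by fun_prop) _ _
      have heq : a * δ + δ⁻¹ * ∫ t in 0..a, ‖f k t‖ ^ 2 =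
          ∫ t in 0..a, (δ + δ⁻¹ * ‖f k t‖ ^ 2) := by
        rw [intervalIntegral.integral_add intervalIntegrable_const (hi.const_mul _),
          intervalIntegral.integral_const_mul]
        simp
      rw [heq]
      refine intervalIntegral.integral_mono_on ha
        (Continuous.intervalIntegrable (by fun_prop) _ _)
        (Continuous.intervalIntegrable (by fun_prop) _ _) fun t _ => ?_
      have h1 : δ * δ⁻¹ = 1 := mul_inv_cancel₀ hδ.ne'
      have h2 : 0 < δ⁻¹ := inv_pos.2 hδ
      nlinarith [mul_nonneg h2.le (sq_nonneg (‖f k t‖ - δ)), norm_nonneg (f k t)]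
    rw [Metric.tendsto_atTop]
    intro ε hε
    set δ := ε / (2 * (a + 1)) with hδ
    have hδ0 : 0 < δ := by positivity
    have haδ : a * δ < ε / 2 := by
      have : (a + 1) * δ = ε / 2 := by rw [hδ]; field_simp
      linarith
    have h0 := hf.const_mul δ⁻¹
    rw [mul_zero] at h0
    obtain ⟨K, hK⟩ := eventually_atTop.1 (h0.eventually (gt_mem_nhds (half_pos hε)))
    refine ⟨K, fun k hk => ?_⟩
    rw [Real.dist_eq, sub_zero, abs_of_nonneg (hnn k)]
    linarith [hle δ hδ0 k, hK k hk]
  have h := hL1.const_mul C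
  rw [mul_zero] at h
  exact squeeze_zero_norm (fun k => hC _) h

/-- Averages of a curve are dense if no non-zero functional vanishes along the curve. -/
theorem denseRange_curveAverage [CompleteSpace X] (ha : 0 < a)
    (hy : ContinuousOn y (Set.Icc 0 a))
    (h : ∀ g : X →L[𝕜] 𝕜, (∀ t ∈ Set.Icc 0 a, g (y t) = 0) → g = 0) :
    DenseRange (curveAverage 𝕜 ha.le hy) := by
  set M := (LinearMap.range (curveAverage 𝕜 ha.le hy)).topologicalClosure with hM
  have hle : LinearMap.range (curveAverage 𝕜 ha.le hy) ≤ M := Submodule.le_topologicalClosure _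
  have : IsClosed (M : Set X) := Submodule.isClosed_topologicalClosure _
  suffices hT : M = ⊤ by
    have := Submodule.dense_iff_topologicalClosure_eq_top.2 hT
    rwa [LinearMap.coe_range] at this
  rw [Submodule.eq_top_iff']
  intro x
  rw [← Submodule.Quotient.mk_eq_zero]
  refine SeparatingDual.eq_zero_of_forall_dual_eq_zero (R := 𝕜) fun q => ?_
  set g : X →L[𝕜] 𝕜 := q.comp M.mkQL with hg
  have hgA : ∀ f : C(ℝ, 𝕜), g (curveAverage 𝕜 ha.le hy f) = 0 := fun f => by
    have : (Submodule.Quotient.mk (curveAverage 𝕜 ha.le hy f) : X ⧸ M) = 0 :=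
      (Submodule.Quotient.mk_eq_zero M).2 (hle ⟨f, rfl⟩)
    change q (Submodule.Quotient.mk (curveAverage 𝕜 ha.le hy f)) = 0
    rw [this, map_zero]
  have hgy : ContinuousOn (fun t => g (y t)) (Set.Icc 0 a) := g.continuous.comp_continuousOn hy
  set f : C(ℝ, 𝕜) := ⟨fun t => (starRingEnd 𝕜) (Set.IccExtend ha.le
    ((Set.Icc 0 a).domRestrict fun t => g (y t)) t), by
      have : Continuous (Set.IccExtend ha.le ((Set.Icc 0 a).domRestrict fun t => g (y t))) :=
        Continuous.Icc_extend' hgy.domRestrict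
      exact RCLike.continuous_conj.comp this⟩ with hf
  have hfy : ∀ t ∈ Set.Icc 0 a, f t * g (y t) = ((‖g (y t)‖ ^ 2 : ℝ) : 𝕜) := fun t ht => by
    change (starRingEnd 𝕜) (Set.IccExtend ha.le _ t) * _ = _
    rw [Set.IccExtend_of_mem _ _ ht]
    rw [Set.domRestrict_apply, RCLike.conj_mul, RCLike.ofReal_pow]
  have hint : ∫ t in 0..a, ‖g (y t)‖ ^ 2 = 0 := by
    have h0 := hgA f
    rw [curveAverage_apply, ← g.intervalIntegral_comp_comm
      (intervalIntegrable_smul_curve ha.le hy f)] at h0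
    simp only [map_smul, smul_eq_mul] at h0
    rw [intervalIntegral.integral_congr (g := fun t => ((‖g (y t)‖ ^ 2 : ℝ) : 𝕜))
      (fun t ht => hfy t (by rwa [Set.uIcc_of_le ha.le] at ht))] at h0
    have hcomm := (RCLike.ofRealCLM (K := 𝕜)).intervalIntegral_comp_comm
      (f := fun t => ‖g (y t)‖ ^ 2) (μ := MeasureTheory.volume) (a := 0) (b := a)
      (ContinuousOn.intervalIntegrable (by rw [Set.uIcc_of_le ha.le]; exact hgy.norm.pow 2))
    exact RCLike.ofReal_eq_zero.1 (hcomm.symm.trans h0)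
  have hg0 : g = 0 := h g fun t ht => by
    by_contra hne
    have hpos : 0 < ∫ t in 0..a, ‖g (y t)‖ ^ 2 :=
      intervalIntegral.integral_pos ha (hgy.norm.pow 2) (fun _ _ => by positivity)
        ⟨t, ht, by positivity⟩
    exact hpos.ne' hint
  change g x = 0
  rw [hg0]
  rfl

end CurveAverage

section Kitai

variable {𝕜 X : Type*} [RCLike 𝕜] [NormedAddCommGroup X] [NormedSpace 𝕜 X]

/-- The map `S` of the Kitai Criterion, obtained by pushing forward a map `R` of a parameter
space. -/
theorem satisfiesKitaiCriterion_of_param {H : Type*} {T : X →L[𝕜] X} {E : Set X} (hE : Dense E)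
    (hTE : ∀ x ∈ E, Tendsto (fun k : ℕ => (T ^ k) x) atTop (𝓝 0)) {B : H → X}
    (hB : DenseRange B) {R : H → H} (hTR : ∀ f, T (B (R f)) = B f)
    (hR : ∀ f, Tendsto (fun k : ℕ => B (R^[k] f)) atTop (𝓝 0))
    (hBR : ∀ f g, B f = B g → B (R f) = B (R g)) : SatisfiesKitaiCriterion T := by
  have hS : ∀ y : Set.range B, ∃ z : Set.range B, ∀ f, B f = y → z = B (R f) := by
    rintro ⟨_, f, rfl⟩
    exact ⟨⟨B (R f), R f, rfl⟩, fun g hg => hBR f g hg.symm⟩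
  choose S hS using hS
  have hiter : ∀ (f : H) (k : ℕ), (S^[k] ⟨B f, f, rfl⟩ : X) = B (R^[k] f) := by
    intro f k
    induction k with
    | zero => rfl
    | succ k ih =>
      rw [Function.iterate_succ_apply', Function.iterate_succ_apply']
      exact hS _ _ ih.symm
  refine ⟨E, Set.range B, S, hE, hB, ?_, ?_, hTE⟩
  · rintro ⟨_, f, rfl⟩
    rw [hS _ f rfl, hTR]
  · rintro ⟨_, f, rfl⟩
    simpa only [hiter] using hR f

variable {e : ℕ → X} {w : ℕ → 𝕜} {T : X →L[𝕜] X}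

theorem IsBackwardWeightedShift.apply_succ (hT : IsBackwardWeightedShift e w T) (n : ℕ) :
    T (e (n + 1)) = w (n + 1) • e n := by
  simpa using hT.apply_basis (n + 1) (by omega)

theorem IsBackwardWeightedShift.denseRange (hT : IsBackwardWeightedShift e w T)
    (he : Dense (Submodule.span 𝕜 (Set.range e) : Set X)) : DenseRange T := by
  have hle : Submodule.span 𝕜 (Set.range e) ≤ LinearMap.range (T : X →ₗ[𝕜] X) := by
    rw [Submodule.span_le]
    rintro _ ⟨n, rfl⟩
    refine ⟨(w (n + 1))⁻¹ • e (n + 1), ?_⟩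
    rw [ContinuousLinearMap.coe_coe, map_smul, hT.apply_succ,
      inv_smul_smul₀ (hT.weight_ne_zero _ (by omega))]
  exact he.mono hle

/-- Normalising factors turning a backward weighted shift into the one with weights `1 / n`. -/
noncomputable def shiftFactor (w : ℕ → 𝕜) (n : ℕ) : 𝕜 :=
  ∏ j ∈ Finset.range n, (((j : 𝕜) + 1) * w (j + 1))⁻¹

theorem shiftFactor_succ_mul (n : ℕ) (hw : w (n + 1) ≠ 0) :
    shiftFactor w (n + 1) * w (n + 1) = ((n : 𝕜) + 1)⁻¹ * shiftFactor w n := by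
  rw [shiftFactor, Finset.prod_range_succ, ← shiftFactor, mul_inv]
  field_simp

theorem shiftFactor_ne_zero (hw : ∀ n, 1 ≤ n → w n ≠ 0) (n : ℕ) : shiftFactor w n ≠ 0 :=
  Finset.prod_ne_zero_iff.2 fun j _ =>
    inv_ne_zero (mul_ne_zero (Nat.cast_add_one_ne_zero j) (hw _ (by omega)))

theorem norm_shiftFactor_le {c : ℝ} (hc : 0 < c) (hw : ∀ n : ℕ, 1 ≤ n → c / (n : ℝ) ≤ ‖w n‖)
    (n : ℕ) : ‖shiftFactor w n‖ ≤ c⁻¹ ^ n := by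
  rw [shiftFactor, norm_prod]
  refine (Finset.prod_le_prod (g := fun _ => c⁻¹) (fun _ _ => norm_nonneg _)
    fun j _ => ?_).trans_eq (by simp)
  have h := hw (j + 1) (by omega)
  rw [div_le_iff₀ (by positivity), mul_comm] at h
  have hj : ‖(j : 𝕜) + 1‖ = ((j + 1 : ℕ) : ℝ) := by
    rw [← Nat.cast_add_one, RCLike.norm_natCast]
  rw [norm_inv, norm_mul, hj]
  gcongr

/-- If a backward weighted shift with respect to a total bounded sequence has weights bounded
below by `c / n`, then its sum with the identity satisfies the Kitai Criterion. -/
theorem IsBackwardWeightedShift.satisfiesKitaiCriterion [CompleteSpace X]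
    (hT : IsBackwardWeightedShift e w T) (he1 : ∀ n, ‖e n‖ ≤ 1)
    (he : Dense (Submodule.span 𝕜 (Set.range e) : Set X)) {c : ℝ} (hc : 0 < c)
    (hw : ∀ n : ℕ, 1 ≤ n → c / (n : ℝ) ≤ ‖w n‖) :
    SatisfiesKitaiCriterion (ContinuousLinearMap.id 𝕜 X + T) := by
  let : NormedSpace ℝ X := NormedSpace.restrictScalars ℝ 𝕜 X
  have : IsScalarTower ℝ 𝕜 X := ⟨fun r k x => by
    change (r • k) • x = (algebraMap ℝ 𝕜 r) • k • x
    rw [Algebra.smul_def, mul_smul]⟩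
  set v : ℕ → X := fun n => shiftFactor w n • e n with hv
  have hvn : ∀ n, ‖v n‖ ≤ c⁻¹ ^ n := fun n => by
    rw [hv, norm_smul]
    exact (mul_le_of_le_one_right (norm_nonneg _) (he1 n)).trans (norm_shiftFactor_le hc hw n)
  have hTv0 : T (v 0) = 0 := by rw [hv, map_smul, hT.apply_zero, smul_zero]
  have hTv : ∀ n : ℕ, T (v (n + 1)) = ((n : ℝ) + 1)⁻¹ • v n := fun n => by
    simp only [hv]
    rw [map_smul, hT.apply_succ, smul_smul, shiftFactor_succ_mul _
      (hT.weight_ne_zero _ (by omega)), mul_smul, RCLike.real_smul_eq_coe_smul (K := 𝕜)]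
    push_cast
    rfl
  have hderiv : ∀ t : ℝ, |t| < c →
      HasDerivAt (fun t => T (powerCurve v t)) (powerCurve v t) t := fun t ht =>
    hasDerivAt_map_powerCurve (T := T.restrictScalars ℝ) hc hvn hTv0 hTv ht
  obtain ⟨a, ha, hac, ha1⟩ : ∃ a : ℝ, 0 < a ∧ a < c ∧ a < 1 := by
    obtain ⟨a, h0, h1⟩ := exists_between (lt_min hc one_pos)
    exact ⟨a, h0, lt_min_iff.1 h1⟩
  have habs : ∀ {σ : ℝ}, |σ| = 1 → ∀ t ∈ Set.Icc 0 a, |σ * t| ≤ a := fun {σ} hσ t ht => by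
    rw [abs_mul, hσ, one_mul, abs_of_nonneg ht.1]
    exact ht.2
  have hcont : ∀ {σ : ℝ}, |σ| = 1 →
      ContinuousOn (fun t => powerCurve v (σ * t)) (Set.Icc 0 a) := fun {σ} hσ =>
    (continuousOn_powerCurve hc hvn ha.le hac).comp (by fun_prop)
      fun t ht => abs_le.1 (habs hσ t ht)
  have hdense : ∀ {σ : ℝ} (hσ : |σ| = 1),
      DenseRange fun f => T (curveAverage 𝕜 ha.le (hcont hσ) f) := fun {σ} hσ => by
    refine (hT.denseRange he).comp (denseRange_curveAverage ha (hcont hσ) fun g hg => ?_)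
      T.continuous
    have hgv : ∀ n, g (v n) = 0 := by
      refine coeff_eq_zero_of_hasSum_zero (G := fun t => g (powerCurve v t)) ha
        (σ := σ) (by rintro rfl; simp at hσ) ?_ hg
      filter_upwards [(continuous_abs.tendsto (0 : ℝ)).eventually
        (gt_mem_nhds (by simpa using hc))] with t ht
      simpa using! (hasSum_powerCurve hc hvn ht).mapL (g.restrictScalars ℝ)
    refine ContinuousLinearMap.ext_on he ?_
    rintro _ ⟨n, rfl⟩
    have := hgv n
    rw [hv, map_smul, smul_eq_zero] at this
    exact this.resolve_left (shiftFactor_ne_zero hT.weight_ne_zero n)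
  have hTA : ∀ {σ : ℝ} (hσ : |σ| = 1) (f : C(ℝ, 𝕜)), T (curveAverage 𝕜 ha.le (hcont hσ) f) =
      (σ : 𝕜) • curveAverage 𝕜 ha.le (hcont hσ) (volterra 𝕜 a f) := fun {σ} hσ f => by
    refine map_curveAverage ha.le (hcont hσ) (by rw [mul_zero, powerCurve_zero, hTv0])
      (fun t ht => ?_) f
    exact (hderiv (σ * t) ((habs hσ t ht).trans_lt hac)).scomp t
      (((hasDerivAt_id t).const_mul σ).congr_deriv (mul_one σ))
  have hpos : |(1 : ℝ)| = 1 := abs_one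
  have hneg : |(-1 : ℝ)| = 1 := by simp
  set A := curveAverage 𝕜 ha.le (hcont hpos) with hA
  set A' := curveAverage 𝕜 ha.le (hcont hneg) with hA'
  have hTA1 : ∀ f, T (A f) = A (volterra 𝕜 a f) := fun f => by
    rw [hTA hpos f, RCLike.ofReal_one, one_smul]
  have hTA' : ∀ f, T (A' f) = -A' (volterra 𝕜 a f) := fun f => by
    rw [hTA hneg f, RCLike.ofReal_neg, RCLike.ofReal_one, neg_one_smul]
  have hker : ∀ f, A f + T (A f) = 0 → A f = 0 := fun f hf => by
    obtain ⟨M, hM⟩ := isCompact_Icc.exists_bound_of_continuousOn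
      (f.continuous.continuousOn (s := Set.Icc 0 a))
    have hpow : ∀ n : ℕ, ‖A (((volterra 𝕜 a) ^ n) f)‖ = ‖A f‖ := by
      have : ∀ n : ℕ, A (((volterra 𝕜 a) ^ n) f) = (-1 : 𝕜) ^ n • A f := fun n => by
        induction n with
        | zero => simp
        | succ n ih =>
          rw [pow_succ', Module.End.mul_apply, ← hTA1, ih, map_smul,
            eq_neg_of_add_eq_zero_right hf, pow_succ, mul_smul, neg_one_smul]
      intro n
      rw [this, norm_smul]
      simp
    have htend : Tendsto (fun n : ℕ => A (((volterra 𝕜 a) ^ n) f)) atTop (𝓝 0) := by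
      obtain ⟨C, hC0, hC⟩ := exists_norm_curveAverage_le (𝕜 := 𝕜) ha.le (hcont hpos)
      have hlim := ((tendsto_pow_atTop_nhds_zero_of_lt_one ha.le ha1).mul_const M).const_mul (C * a)
      rw [zero_mul, mul_zero] at hlim
      refine squeeze_zero_norm (fun n => (hC _).trans ?_) hlim
      rw [mul_assoc]
      gcongr
      have := intervalIntegral.integral_mono_on (μ := MeasureTheory.volume) ha.le
        (Continuous.intervalIntegrable (by fun_prop) _ _) intervalIntegrable_const
        (norm_volterra_pow_le hM n)
      rwa [intervalIntegral.integral_const, sub_zero, smul_eq_mul] at this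
    have h := htend.norm
    simp only [hpow, norm_zero] at h
    exact norm_eq_zero.1 (tendsto_nhds_unique tendsto_const_nhds h)
  have hres : ∀ f, A (volterraResolvent 𝕜 a f) + T (A (volterraResolvent 𝕜 a f)) = A f :=
    fun f => by rw [hTA1, ← map_add, volterraResolvent_add_volterra]
  refine satisfiesKitaiCriterion_of_param (E := Set.range fun f => T (A' f))
    (B := fun f => T (A f)) (R := volterraResolvent 𝕜 a) (hdense hneg) ?_ (hdense hpos)
    (fun f => ?_) (fun f => ?_) (fun f g hfg => ?_)
  · rintro _ ⟨f, rfl⟩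
    have hiter : ∀ k : ℕ, ((ContinuousLinearMap.id 𝕜 X + T) ^ k) (T (A' f)) =
        -A' (volterra 𝕜 a (((1 - volterra 𝕜 a) ^ k) f)) := fun k => by
      rw [← hTA']
      induction k with
      | zero => simp
      | succ k ih =>
        rw [pow_succ', mul_apply_eq_comp, ih, pow_succ', Module.End.mul_apply,
          add_apply, ContinuousLinearMap.id_apply, ← map_add, hTA' (_),
          ← sub_eq_add_neg, ← map_sub]
        rfl
    simp only [hiter]
    rw [← neg_zero]
    exact (tendsto_curveAverage_zero ha.le (hcont hneg)
      (tendsto_integral_norm_sq_volterra_pow ha.le f)).neg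
  · rw [add_apply, ContinuousLinearMap.id_apply, ← map_add, hres]
  · simp only [hTA1]
    exact tendsto_curveAverage_zero ha.le (hcont hpos)
      (tendsto_integral_norm_sq_volterra_volterraResolvent ha.le f)
  · rw [← sub_eq_zero, hTA1, hTA1, ← map_sub]
    refine hker _ ?_
    rw [map_sub, ← hTA1, ← hTA1]
    calc _ = T (A (volterraResolvent 𝕜 a f) + T (A (volterraResolvent 𝕜 a f))) -
          T (A (volterraResolvent 𝕜 a g) + T (A (volterraResolvent 𝕜 a g))) := by
          simp only [map_sub, map_add]
          abel
      _ = 0 := by rw [hres, hres, hfg, sub_self]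

end Kitai

section SequenceSpaces

variable (𝕜 : Type*) [RCLike 𝕜]

theorem norm_lpBasis_le (p : ℝ≥0∞) [Fact (1 ≤ p)] (n : ℕ) : ‖lpBasis 𝕜 p n‖ ≤ 1 := by
  rw [lpBasis, lp.norm_single (zero_lt_one.trans_le Fact.out), norm_one]

theorem dense_span_lpBasis (p : ℝ≥0∞) [Fact (1 ≤ p)] (hp : p ≠ ∞) :
    Dense (Submodule.span 𝕜 (Set.range (lpBasis 𝕜 p)) : Set (lp (fun _ : ℕ => 𝕜) p)) := by
  intro x
  refine mem_closure_of_tendsto (lp.hasSum_single hp x) (Eventually.of_forall fun s => ?_)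
  refine Submodule.sum_mem _ fun n _ => ?_
  have : lp.single p n (x n) = x n • lpBasis 𝕜 p n := by
    rw [lpBasis, ← lp.single_smul, smul_eq_mul, mul_one]
  rw [this]
  exact Submodule.smul_mem _ _ (Submodule.subset_span ⟨n, rfl⟩)

theorem c0Basis_apply (n m : ℕ) : c0Basis 𝕜 n m = (Pi.single n (1 : 𝕜) : ℕ → 𝕜) m := rfl

theorem ZeroAtInftyContinuousMap.norm_le_of_forall_le {f : C₀(ℕ, 𝕜)} {C : ℝ} (hC : 0 ≤ C)
    (h : ∀ n, ‖f n‖ ≤ C) : ‖f‖ ≤ C := by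
  rw [← ZeroAtInftyContinuousMap.norm_toBCF_eq_norm]
  exact (BoundedContinuousFunction.norm_le hC).2 h

theorem norm_c0Basis_le (n : ℕ) : ‖c0Basis 𝕜 n‖ ≤ 1 := by
  refine ZeroAtInftyContinuousMap.norm_le_of_forall_le 𝕜 zero_le_one fun m => ?_
  rw [c0Basis_apply, Pi.single_apply]
  split_ifs <;> simp

theorem dense_span_c0Basis :
    Dense (Submodule.span 𝕜 (Set.range (c0Basis 𝕜)) : Set C₀(ℕ, 𝕜)) := by
  intro x
  rw [Metric.mem_closure_iff]
  intro ε hε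
  have hx : Tendsto x atTop (𝓝 0) := by simpa using x.zero_at_infty'
  rw [Metric.tendsto_atTop] at hx
  obtain ⟨N, hN⟩ := hx (ε / 2) (half_pos hε)
  set z : C₀(ℕ, 𝕜) := ∑ n ∈ Finset.range N, x n • c0Basis 𝕜 n with hz
  refine ⟨z, Submodule.sum_mem _ fun n _ =>
    Submodule.smul_mem _ _ (Submodule.subset_span ⟨n, rfl⟩), ?_⟩
  have hzm : ∀ m, z m = if m < N then x m else 0 := fun m => by
    have : z m = ∑ n ∈ Finset.range N, x n * (Pi.single n (1 : 𝕜) : ℕ → 𝕜) m := by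
      let evalHom : C₀(ℕ, 𝕜) →+ 𝕜 :=
        { toFun := fun f => f m, map_zero' := rfl, map_add' := fun _ _ => rfl }
      exact map_sum evalHom (fun n => x n • c0Basis 𝕜 n) (Finset.range N)
    simp [this, Pi.single_apply]
  rw [dist_eq_norm]
  refine (ZeroAtInftyContinuousMap.norm_le_of_forall_le 𝕜 (half_pos hε).le fun m => ?_).trans_lt
    (half_lt_self hε)
  rw [ZeroAtInftyContinuousMap.sub_apply, hzm]
  split_ifs with h
  · simpa using (half_pos hε).le
  · simpa using (hN m (not_lt.1 h)).le

end SequenceSpaces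

theorem corollary3 {𝕜 : Type*} [RCLike 𝕜] (w : ℕ → 𝕜)
    (hw : ∃ c : ℝ, 0 < c ∧ ∀ n : ℕ, 1 ≤ n → c / (n : ℝ) ≤ ‖w n‖) :
    (∀ (p : ℝ≥0∞) [Fact (1 ≤ p)], p ≠ ∞ →
      ∀ T : lp (fun _ : ℕ => 𝕜) p →L[𝕜] lp (fun _ : ℕ => 𝕜) p,
        IsBackwardWeightedShift (lpBasis 𝕜 p) w T →
          SatisfiesKitaiCriterion (ContinuousLinearMap.id 𝕜 (lp (fun _ : ℕ => 𝕜) p) + T)) ∧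
    (∀ T : C₀(ℕ, 𝕜) →L[𝕜] C₀(ℕ, 𝕜),
      IsBackwardWeightedShift (c0Basis 𝕜) w T →
        SatisfiesKitaiCriterion (ContinuousLinearMap.id 𝕜 C₀(ℕ, 𝕜) + T)) := by
  obtain ⟨c, hc, hw⟩ := hw
  exact ⟨fun p _ hp T hT => hT.satisfiesKitaiCriterion (norm_lpBasis_le 𝕜 p)
      (dense_span_lpBasis 𝕜 p hp) hc hw,
    fun T hT => hT.satisfiesKitaiCriterion (norm_c0Basis_le 𝕜) (dense_span_c0Basis 𝕜) hc hw⟩
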